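/- For $n\ge 0$ put $[n]=1+q+\cdots+q^{n-1}$, $[n]!=[1][2]\cdots[n]$, ${2n\brack n}=\frac{[2n]!}{[n]!\,[n]!}$, and let $$C_n(q)=\frac{1}{[n+1]}{2n\brack n}=\sum_k m_n(k)\,q^k$$ be the $q$-Catalan number, a polynomial with nonnegative integer coefficients and with $C_n(1)=C_n=\frac{1}{n+1}\binom{2n}{n}$. Let $\xi_n$ be a random variable with probability generating function $C_n(q)/C_n$, that is, $P(\xi_n=k)=m_n(k)/C_n$ for all $k\ge 0$. Then, for every $n$, $$E(\xi_n)=\frac{n(n-1)}{2},\qquad \mathrm{Var}(\xi_n)=\frac{n(n-1)(n+1)}{6},$$ and, as $n\to\infty$, the standardized variable $$\eta_n=\frac{\xi_n-E(\xi_n)}{\mathrm{Var}(\xi_n)^{1/2}}=\frac{\xi_n-\frac{n(n-1)}{2}}{\sqrt{n(n-1)(n+1)/6}}$$ converges in distribution to the standard normal law $N(0,1)$. -/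

import Mathlib

open Polynomial MeasureTheory ProbabilityTheory Filter

/-- The `q`-number `[n] = 1 + q + ⋯ + q ^ (n - 1)`, as a polynomial in `q`. -/
noncomputable def qNumber (n : ℕ) : ℤ[X] := ∑ i ∈ Finset.range n, X ^ i

/-- The `q`-factorial `[n]! = [1] [2] ⋯ [n]`. -/
noncomputable def qFactorial (n : ℕ) : ℤ[X] := ∏ i ∈ Finset.range n, qNumber (i + 1)

/-- The `q`-binomial coefficient `[n]! / ([k]! [n-k]!)` (and `0` if `k > n`). The divisor is
monic, so the polynomial division `/ₘ` makes sense. -/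
noncomputable def qBinomial (n k : ℕ) : ℤ[X] :=
  if k ≤ n then qFactorial n /ₘ (qFactorial k * qFactorial (n - k)) else 0

/-- The `q`-Catalan number `C_n(q) = (1 / [n+1]) [2n choose n]_q`. The division by the monic
polynomial `[n+1]` is exact, see `qNumber_mul_qCatalan` and `qFactorial_mul_qBinomial`. -/
noncomputable def qCatalan (n : ℕ) : ℤ[X] := qBinomial (2 * n) n /ₘ qNumber (n + 1)

lemma X_sub_one_mul_qNumber (n : ℕ) : (X - 1) * qNumber n = X ^ n - 1 :=
  mul_geom_sum X n

lemma qFactorial_succ (n : ℕ) : qFactorial (n + 1) = qFactorial n * qNumber (n + 1) :=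
  Finset.prod_range_succ _ n

lemma monic_qNumber_succ (n : ℕ) : (qNumber (n + 1)).Monic :=
  monic_geom_sum_X n.succ_ne_zero

lemma monic_qFactorial (n : ℕ) : (qFactorial n).Monic :=
  monic_prod_of_monic _ _ fun i _ => monic_qNumber_succ i

lemma isCoprime_X_qFactorial (n : ℕ) : IsCoprime (X : ℤ[X]) (qFactorial n) := by
  refine IsCoprime.prod_right fun i _ => ?_
  refine ⟨-qNumber i, 1, ?_⟩
  have h : qNumber (i + 1) = X * qNumber i + 1 := geom_sum_succ
  rw [h]
  ring

lemma eval_one_qFactorial (n : ℕ) : (qFactorial n).eval 1 = (n.factorial : ℤ) := by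
  induction n with
  | zero => simp [qFactorial]
  | succ n ih =>
    rw [qFactorial_succ, eval_mul, ih, Nat.factorial_succ]
    simp [qNumber, eval_finsetSum]
    ring

/-- The generating functions by major index of the ballot words with `m + d` letters `0` and
`m` letters `1`: they have nonnegative coefficients and a product formula. -/
lemma exists_ballot_polynomial (m : ℕ) : ∃ A V : ℕ → ℤ[X],
    (∀ d k, 0 ≤ (A d).coeff k) ∧ (∀ d k, 0 ≤ (V d).coeff k) ∧
    (∀ d, A (d + 1) = A d + V (d + 1)) ∧
    ∀ d, A d * (qFactorial (m + d + 1) * qFactorial m) =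
      X ^ m * qNumber (d + 1) * qFactorial (2 * m + d) := by
  have hX : (X - 1 : ℤ[X]) ≠ 0 := X_sub_C_ne_zero (1 : ℤ)
  induction m with
  | zero =>
    refine ⟨fun _ => 1, fun _ => 0, fun d k => ?_, fun d k => by simp, fun d => by simp,
      fun d => ?_⟩
    · rw [coeff_one]; split_ifs <;> simp
    · simp only [Nat.mul_zero, Nat.zero_add, qFactorial_succ]
      simp [qFactorial]
      ring
  | succ m ih =>
    obtain ⟨A, V, hA, hV, hAV, hF⟩ := ih
    let V' : ℕ → ℤ[X] := fun d => V (d + 1) + A d * X ^ (2 * m + d + 1)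
    have hV'0 : ∀ d k, 0 ≤ (V' d).coeff k := by
      intro d k
      simp only [V', coeff_add, coeff_mul_X_pow']
      split_ifs
      · exact add_nonneg (hV _ _) (hA _ _)
      · simpa using hV _ _
    have hV' : ∀ d, V' d = A (d + 1) + (X - 1) * qNumber (2 * m + d + 1) * A d := by
      intro d
      rw [X_sub_one_mul_qNumber, hAV]
      simp only [V']
      ring
    refine ⟨fun d => ∑ j ∈ Finset.range (d + 1), V' j, V', fun d k => ?_, hV'0,
      fun d => Finset.sum_range_succ _ _, fun d => ?_⟩
    · rw [finsetSum_coeff]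
      exact Finset.sum_nonneg fun j _ => hV'0 j k
    · induction d with
      | zero =>
        have h0 := hF 0
        have h1 := hF 1
        have key : qNumber (m + 1) * qNumber 2 +
            (X - 1) * qNumber (m + 1) * qNumber (m + 2) * qNumber 1
            = X * qNumber 1 * qNumber (2 * m + 2) := by
          apply mul_left_cancel₀ hX
          apply mul_left_cancel₀ hX
          have e1 := X_sub_one_mul_qNumber (m + 1)
          have e2 := X_sub_one_mul_qNumber 2
          have e3 := X_sub_one_mul_qNumber (m + 2)
          have e4 := X_sub_one_mul_qNumber 1
          have e5 := X_sub_one_mul_qNumber (2 * m + 2)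
          calc _ = ((X - 1) * qNumber (m + 1)) * ((X - 1) * qNumber 2) +
                ((X - 1) * qNumber (m + 1)) * ((X - 1) * qNumber (m + 2)) *
                  ((X - 1) * qNumber 1) := by ring
            _ = X * ((X - 1) * qNumber 1) * ((X - 1) * qNumber (2 * m + 2)) := by
                rw [e1, e2, e3, e4, e5]; ring
            _ = _ := by ring
        change (∑ j ∈ Finset.range (0 + 1), V' j) * _ = _
        rw [Nat.zero_add, Finset.sum_range_one, hV']
        simp only [Nat.add_zero, Nat.zero_add] at h0 h1 ⊢
        rw [show 2 * (m + 1) = 2 * m + 1 + 1 by ring]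
        rw [qFactorial_succ (2 * m)] at h1
        rw [qFactorial_succ (m + 1)] at h1 ⊢
        rw [qFactorial_succ m] at h0 h1 ⊢
        rw [qFactorial_succ (2 * m + 1), qFactorial_succ (2 * m), pow_succ]
        linear_combination (qNumber (m + 1)) * h1 +
          (X - 1) * qNumber (2 * m + 1) * qNumber (m + 1) * qNumber (m + 2) * h0 +
          X ^ m * qFactorial (2 * m) * qNumber (2 * m + 1) * key
      | succ d ihd =>
        have h0 := hF (d + 1)
        have h1 := hF (d + 2)
        have key : X * qNumber (m + d + 3) * qNumber (d + 1) + qNumber (m + 1) * qNumber (d + 3) +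
            (X - 1) * qNumber (m + 1) * qNumber (m + d + 3) * qNumber (d + 2)
            = X * qNumber (d + 2) * qNumber (2 * m + d + 3) := by
          apply mul_left_cancel₀ hX
          apply mul_left_cancel₀ hX
          have e1 := X_sub_one_mul_qNumber (m + 1)
          have e2 := X_sub_one_mul_qNumber (d + 1)
          have e3 := X_sub_one_mul_qNumber (d + 2)
          have e4 := X_sub_one_mul_qNumber (d + 3)
          have e5 := X_sub_one_mul_qNumber (m + d + 3)
          have e6 := X_sub_one_mul_qNumber (2 * m + d + 3)
          calc _ = X * ((X - 1) * qNumber (m + d + 3)) * ((X - 1) * qNumber (d + 1)) +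
                ((X - 1) * qNumber (m + 1)) * ((X - 1) * qNumber (d + 3)) +
                ((X - 1) * qNumber (m + 1)) * ((X - 1) * qNumber (m + d + 3)) *
                  ((X - 1) * qNumber (d + 2)) := by ring
            _ = X * ((X - 1) * qNumber (d + 2)) * ((X - 1) * qNumber (2 * m + d + 3)) := by
                rw [e1, e2, e3, e4, e5, e6]; ring
            _ = _ := by ring
        change (∑ j ∈ Finset.range (d + 1 + 1), V' j) * _ = _
        change (∑ j ∈ Finset.range (d + 1), V' j) * _ = _ at ihd
        rw [Finset.sum_range_succ, hV' (d + 1)]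
        rw [show m + (d + 1) + 1 = m + d + 2 by ring,
          show 2 * m + (d + 1) = 2 * m + d + 1 by ring] at h0
        rw [show m + (d + 2) + 1 = m + d + 2 + 1 by ring,
          show 2 * m + (d + 2) = 2 * m + d + 1 + 1 by ring, qFactorial_succ (m + d + 2),
          qFactorial_succ (2 * m + d + 1)] at h1
        rw [show m + 1 + d + 1 = m + d + 2 by ring,
          show 2 * (m + 1) + d = 2 * m + d + 1 + 1 by ring, qFactorial_succ m,
          qFactorial_succ (2 * m + d + 1), pow_succ] at ihd
        rw [show m + 1 + (d + 1) + 1 = m + d + 2 + 1 by ring,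
          show 2 * (m + 1) + (d + 1) = 2 * m + d + 1 + 1 + 1 by ring, qFactorial_succ m,
          qFactorial_succ (m + d + 2), qFactorial_succ (2 * m + d + 1 + 1),
          qFactorial_succ (2 * m + d + 1), pow_succ,
          show 2 * m + (d + 1) + 1 = 2 * m + d + 1 + 1 by ring]
        linear_combination qNumber (m + d + 3) * ihd + qNumber (m + 1) * h1 +
          (X - 1) * qNumber (2 * m + d + 2) * qNumber (m + 1) * qNumber (m + d + 3) * h0 +
          X ^ m * qFactorial (2 * m + d + 1) * qNumber (2 * m + d + 2) * key

lemma exists_qCatalan_aux (n : ℕ) : ∃ A c : ℤ[X], (∀ k, 0 ≤ A.coeff k) ∧ A = X ^ n * c ∧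
    qFactorial (2 * n) = (qFactorial n * qFactorial n) * (qNumber (n + 1) * c) := by
  obtain ⟨A, -, hA, -, -, hF⟩ := exists_ballot_polynomial n
  have h := hF 0
  have h1 : qNumber (0 + 1) = 1 := by simp [qNumber]
  simp only [h1, Nat.add_zero, mul_one] at h
  have hcop : IsCoprime (qFactorial (n + 1) * qFactorial n) ((X : ℤ[X]) ^ n) :=
    (IsCoprime.mul_right ((isCoprime_X_qFactorial _).pow_left)
      ((isCoprime_X_qFactorial _).pow_left)).symm
  obtain ⟨c, hc⟩ := hcop.dvd_of_dvd_mul_left (Dvd.intro_left _ h)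
  have hmon := (monic_qFactorial (n + 1)).mul (monic_qFactorial n)
  refine ⟨A 0, c, hA 0, ?_, ?_⟩
  · apply mul_right_cancel₀ hmon.ne_zero
    rw [h, hc]
    ring
  · rw [hc, qFactorial_succ]
    ring

lemma qBinomial_eq_of (n : ℕ) {c : ℤ[X]}
    (h : qFactorial (2 * n) = (qFactorial n * qFactorial n) * c) : qBinomial (2 * n) n = c := by
  rw [qBinomial, if_pos (by omega), show 2 * n - n = n by omega, h,
    mul_divByMonic_cancel_left _ ((monic_qFactorial n).mul (monic_qFactorial n))]

/-- The division that defines the central `q`-binomial coefficient is exact. -/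
lemma qFactorial_mul_qBinomial (n : ℕ) :
    qFactorial n * qFactorial n * qBinomial (2 * n) n = qFactorial (2 * n) := by
  obtain ⟨A, c, -, -, h⟩ := exists_qCatalan_aux n
  rw [qBinomial_eq_of n h, h]

lemma exists_qCatalan (n : ℕ) : ∃ A : ℤ[X], (∀ k, 0 ≤ A.coeff k) ∧ A = X ^ n * qCatalan n ∧
    qNumber (n + 1) * qCatalan n = qBinomial (2 * n) n := by
  obtain ⟨A, c, hA, hc, h⟩ := exists_qCatalan_aux n
  have hq : qCatalan n = c := by
    rw [qCatalan, qBinomial_eq_of n h, mul_divByMonic_cancel_left _ (monic_qNumber_succ n)]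
  exact ⟨A, hA, by rw [hq, hc], by rw [hq, qBinomial_eq_of n h]⟩

/-- The division that defines the `q`-Catalan number is exact. -/
lemma qNumber_mul_qCatalan (n : ℕ) : qNumber (n + 1) * qCatalan n = qBinomial (2 * n) n :=
  (exists_qCatalan n).choose_spec.2.2

/-- The coefficients of the `q`-Catalan number are nonnegative. -/
lemma qCatalan_coeff_nonneg (n k : ℕ) : 0 ≤ (qCatalan n).coeff k := by
  obtain ⟨A, hA, h, -⟩ := exists_qCatalan n
  have := hA (k + n)
  rwa [h, coeff_X_pow_mul] at this

/-- `C_n(1) = C_n`. -/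
lemma qCatalan_eval_one (n : ℕ) : (qCatalan n).eval 1 = (catalan n : ℤ) := by
  have h := congrArg (eval (1 : ℤ)) (qFactorial_mul_qBinomial n)
  rw [← qNumber_mul_qCatalan] at h
  have hn : (qNumber (n + 1)).eval 1 = ((n + 1 : ℕ) : ℤ) := by simp [qNumber, eval_finsetSum]
  simp only [eval_mul, eval_one_qFactorial, hn] at h
  have h2 : ((n.factorial * n.factorial * ((n + 1) * catalan n) : ℕ) : ℤ)
      = ((2 * n).factorial : ℕ) := by
    rw [succ_mul_catalan_eq_centralBinom, Nat.centralBinom_eq_two_mul_choose]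
    have := Nat.choose_mul_factorial_mul_factorial (show n ≤ 2 * n by omega)
    rw [show 2 * n - n = n by omega] at this
    rw [← this]
    push_cast
    ring
  rw [← h2] at h
  have h3 : ((n.factorial * n.factorial * (n + 1) : ℕ) : ℤ) ≠ 0 := by positivity
  apply mul_left_cancel₀ h3
  push_cast at h ⊢
  linear_combination h

lemma catalan_pos (n : ℕ) : 0 < catalan n := by
  have h := succ_mul_catalan_eq_centralBinom n
  have := n.centralBinom_pos
  rw [← h] at this
  exact Nat.pos_of_mul_pos_left this

/-- The law with probability generating function `C_n(q) / C_n`: the integer `k` has probability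
`m_n(k) / C_n`, where `C_n(q) = ∑ m_n(k) q ^ k`. -/
noncomputable def qCatalanPMF (n : ℕ) : PMF ℕ :=
  PMF.ofFinset (fun k => ENNReal.ofReal ((qCatalan n).coeff k / catalan n)) (qCatalan n).support
    (by
      have hpos : (0 : ℝ) < catalan n := by exact_mod_cast catalan_pos n
      rw [← ENNReal.ofReal_sum_of_nonneg, ← Finset.sum_div]
      · have h := qCatalan_eval_one n
        rw [eval_eq_sum, Polynomial.sum] at h
        simp only [one_pow, mul_one] at h
        have h' : ∑ k ∈ (qCatalan n).support, ((qCatalan n).coeff k : ℝ) = catalan n := by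
          exact_mod_cast h
        rw [h', div_self hpos.ne', ENNReal.ofReal_one]
      · intro k _
        exact div_nonneg (by exact_mod_cast qCatalan_coeff_nonneg n k) hpos.le)
    (by
      intro k hk
      simp [notMem_support_iff.mp hk])

/-- The probability generating function of `qCatalanPMF n` is `C_n(q) / C_n`. -/
lemma qCatalanPMF_pgf (n : ℕ) (q : ℝ) :
    ∫ k, q ^ k ∂(qCatalanPMF n).toMeasure = aeval q (qCatalan n) / catalan n := by
  have hpos : (0 : ℝ) < catalan n := by exact_mod_cast catalan_pos n
  have hreal : ∀ k, (qCatalanPMF n k).toReal = ((qCatalan n).coeff k : ℝ) / catalan n := by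
    intro k
    rw [qCatalanPMF, PMF.ofFinset_apply]
    exact ENNReal.toReal_ofReal
      (div_nonneg (by exact_mod_cast qCatalan_coeff_nonneg n k) hpos.le)
  have hfin : (∫ k, q ^ k ∂(qCatalanPMF n).toMeasure)
      = ∑ k ∈ (qCatalan n).support, (qCatalanPMF n k).toReal • q ^ k := by
    have hsupp : (qCatalanPMF n).toMeasure.restrict ((qCatalan n).support : Set ℕ)
        = (qCatalanPMF n).toMeasure := by
      rw [Measure.restrict_eq_self_of_ae_mem]
      rw [ae_iff]
      rw [PMF.toMeasure_apply_eq_zero_iff _ (by measurability)]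
      rw [Set.disjoint_left]
      intro k hk hk'
      apply hk
      rw [qCatalanPMF, PMF.ofFinset_apply]
      simp [notMem_support_iff.mp hk']
    rw [← hsupp, setIntegral_finset]
    · refine Finset.sum_congr rfl fun k _ => ?_
      rw [measureReal_def, PMF.toMeasure_apply_singleton _ _ (by measurability)]
    · exact IntegrableOn.finset
  rw [hfin, aeval_def, eval₂_eq_sum, Polynomial.sum, Finset.sum_div]
  refine Finset.sum_congr rfl fun k _ => ?_
  rw [hreal]
  simp
  ring

/-! Everything follows from the product formula `[n]! [n+1]! C_n(q) = [2n]!`, which turns questions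
about `C_n` into sums over the factors `[m]`.

Moments: the first two logarithmic derivatives at `q = 1` are additive over products and explicit on
each `[m]`. They give the mean, and the variance as the second one plus the mean
(`logDerivOne_qCatalan`, `logDerivTwo_qCatalan`).

Limit law: at `q = exp (2ix)` the factor `[m]` equals a phase times `m sinc (mx) / sinc x` when
`sinc x ≠ 0`. Hence `C_n(q) / C_n` is the phase of the mean times a real quotient of products of
`sinc (ix)` (`aeval_exp_qCatalan_div`). As `log (sinc y) = -y²/6 + O(y⁴)`, the logarithm of that
quotient is `-n(n-1)(n+1)x²/3 + O(n⁵x⁴)` for `2n|x| ≤ 1` (`abs_log_sincProd_ratio_add_le`). With `2x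
= t/σ` and `σ²` the variance, the main term is `-t²/2` and the error is `O(t⁴/n)`. Pointwise
convergence of characteristic functions then gives convergence in distribution. -/

/-- The product formula `[n]! [n+1]! C_n(q) = [2n]!`. -/
lemma qFactorial_mul_qFactorial_succ_mul_qCatalan (n : ℕ) :
    qFactorial n * qFactorial (n + 1) * qCatalan n = qFactorial (2 * n) := by
  rw [← qFactorial_mul_qBinomial, ← qNumber_mul_qCatalan, qFactorial_succ]
  ring

/-! ### Expectations under the law -/

lemma toReal_qCatalanPMF_apply (n k : ℕ) :
    (qCatalanPMF n k).toReal = ((qCatalan n).coeff k : ℝ) / catalan n := by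
  have hpos : (0 : ℝ) < catalan n := by exact_mod_cast catalan_pos n
  rw [qCatalanPMF, PMF.ofFinset_apply]
  exact ENNReal.toReal_ofReal (div_nonneg (by exact_mod_cast qCatalan_coeff_nonneg n k) hpos.le)

lemma restrict_support_toMeasure_qCatalanPMF (n : ℕ) :
    (qCatalanPMF n).toMeasure.restrict ((qCatalan n).support : Set ℕ)
      = (qCatalanPMF n).toMeasure := by
  rw [Measure.restrict_eq_self_of_ae_mem]
  rw [ae_iff, PMF.toMeasure_apply_eq_zero_iff _ (by measurability), Set.disjoint_left]
  intro k hk hk'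
  apply hk
  rw [qCatalanPMF, PMF.ofFinset_apply]
  simp [notMem_support_iff.mp hk']

lemma integral_qCatalanPMF {E : Type*} [NormedAddCommGroup E] [NormedSpace ℝ E] [CompleteSpace E]
    (n : ℕ) (f : ℕ → E) :
    ∫ k, f k ∂(qCatalanPMF n).toMeasure
      = ∑ k ∈ (qCatalan n).support, (((qCatalan n).coeff k : ℝ) / catalan n) • f k := by
  rw [← restrict_support_toMeasure_qCatalanPMF, setIntegral_finset]
  · refine Finset.sum_congr rfl fun k _ => ?_
    rw [measureReal_def, PMF.toMeasure_apply_singleton _ _ (by measurability),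
      toReal_qCatalanPMF_apply]
  · exact IntegrableOn.finset

lemma integrable_qCatalanPMF {E : Type*} [NormedAddCommGroup E] (n : ℕ) (f : ℕ → E) :
    Integrable f (qCatalanPMF n).toMeasure := by
  rw [← restrict_support_toMeasure_qCatalanPMF]
  exact IntegrableOn.finset

lemma integral_cast_qCatalanPMF (n : ℕ) :
    ∫ k, (k : ℝ) ∂(qCatalanPMF n).toMeasure
      = aeval (1 : ℝ) (derivative (qCatalan n)) / catalan n := by
  rw [integral_qCatalanPMF, derivative_apply, Polynomial.sum, map_sum, Finset.sum_div]
  refine Finset.sum_congr rfl fun k _ => ?_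
  simp
  ring

/-- Write `k² = k(k-1) + k`: the second derivative at `1` gives the factorial moment. -/
lemma integral_cast_sq_qCatalanPMF (n : ℕ) :
    ∫ k, (k : ℝ) ^ 2 ∂(qCatalanPMF n).toMeasure
      = (aeval (1 : ℝ) (derivative (derivative (qCatalan n)))
        + aeval (1 : ℝ) (derivative (qCatalan n))) / catalan n := by
  rw [integral_qCatalanPMF, derivative_apply (qCatalan n), Polynomial.sum, derivative_sum,
    map_sum, map_sum, ← Finset.sum_add_distrib, Finset.sum_div]
  refine Finset.sum_congr rfl fun k _ => ?_
  rcases k with _ | k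
  · simp
  · simp [derivative_X_pow]
    ring

/-- For `z` on the unit circle this is the characteristic function of the law. -/
lemma integral_pow_complex_qCatalanPMF (n : ℕ) (z : ℂ) :
    ∫ k, z ^ k ∂(qCatalanPMF n).toMeasure = aeval z (qCatalan n) / catalan n := by
  rw [integral_qCatalanPMF, aeval_def, eval₂_eq_sum, Polynomial.sum, Finset.sum_div]
  refine Finset.sum_congr rfl fun k _ => ?_
  rw [Complex.real_smul]
  push_cast
  simp only [eq_intCast]
  ring

/-! ### The factorial on the unit circle -/

/-- On the unit circle `[m]` is, up to a phase, a quotient of values of `sinc`. -/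
lemma sinc_mul_aeval_qNumber (m : ℕ) (x : ℝ) :
    (Real.sinc x : ℂ) * aeval (Complex.exp (2 * x * Complex.I)) (qNumber (m + 1))
      = Complex.exp (m * x * Complex.I) * (m + 1) * (Real.sinc ((m + 1) * x) : ℝ) := by
  rcases eq_or_ne x 0 with rfl | hx
  · simp [qNumber]
  have hm : ((m : ℝ) + 1) ≠ 0 := by positivity
  rw [Real.sinc_of_ne_zero hx, Real.sinc_of_ne_zero (mul_ne_zero hm hx)]
  have h := congrArg (aeval (Complex.exp (2 * x * Complex.I))) (X_sub_one_mul_qNumber (m + 1))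
  simp only [map_mul, map_sub, map_pow, aeval_X, map_one] at h
  have hxC : (x : ℂ) ≠ 0 := by exact_mod_cast hx
  have hmC : ((m : ℂ) + 1) ≠ 0 := by exact_mod_cast hm
  -- Used at `y = x` and `y = (m+1)x` to rewrite both sides of `(q - 1)[m+1] = q^(m+1) - 1` with
  -- sines.
  have hsin : ∀ y : ℂ, Complex.exp (y * Complex.I) * Complex.sin y * (2 * Complex.I)
      = Complex.exp (2 * y * Complex.I) - 1 := by
    intro y
    rw [Complex.sin]
    have h1 : Complex.exp (y * Complex.I) * Complex.exp (-y * Complex.I) = 1 := by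
      rw [← Complex.exp_add]; simp
    have h2 : Complex.exp (y * Complex.I) * Complex.exp (y * Complex.I)
        = Complex.exp (2 * y * Complex.I) := by
      rw [← Complex.exp_add]; ring_nf
    linear_combination (Complex.exp (y * Complex.I) * Complex.exp (-y * Complex.I)
      - Complex.exp (y * Complex.I) * Complex.exp (y * Complex.I)) * Complex.I_sq - h1 + h2
  have h2 : Complex.exp (2 * x * Complex.I) ^ (m + 1)
      = Complex.exp (2 * ((m + 1) * x) * Complex.I) := by
    rw [← Complex.exp_nat_mul]; push_cast; ring_nf
  have h3 : Complex.exp (((m + 1) * x) * Complex.I)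
      = Complex.exp (m * x * Complex.I) * Complex.exp (x * Complex.I) := by
    rw [← Complex.exp_add]; ring_nf
  rw [h2, ← hsin, ← hsin, h3] at h
  have hne : Complex.exp (x * Complex.I) * (2 * Complex.I) ≠ 0 :=
    mul_ne_zero (Complex.exp_ne_zero _) (by simp)
  push_cast
  apply mul_left_cancel₀ hne
  have hr : ((m : ℂ) + 1) * (Complex.sin ((m + 1) * x) / ((m + 1) * x))
      = Complex.sin ((m + 1) * x) / x := by
    field_simp
  linear_combination h / x - Complex.exp (x * Complex.I) * (2 * Complex.I) *
    Complex.exp (m * x * Complex.I) * hr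

/-- The product `∏ sinc (i x)` over `1 ≤ i ≤ n`. -/
noncomputable def sincProd (n : ℕ) (x : ℝ) : ℝ := ∏ i ∈ Finset.range n, Real.sinc ((i + 1) * x)

lemma sincProd_succ (n : ℕ) (x : ℝ) :
    sincProd (n + 1) x = sincProd n x * Real.sinc ((n + 1) * x) :=
  Finset.prod_range_succ _ n

/-- Multiply the identities for `[1], …, [n]`; the phases add up to `0 + 1 + ⋯ + (n-1)`. -/
lemma sinc_pow_mul_aeval_qFactorial (n : ℕ) (x : ℝ) :
    (Real.sinc x : ℂ) ^ n * aeval (Complex.exp (2 * x * Complex.I)) (qFactorial n)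
      = Complex.exp ((n * (n - 1) / 2) * x * Complex.I) * n.factorial * (sincProd n x : ℝ) := by
  induction n with
  | zero => simp [qFactorial, sincProd]
  | succ n ih =>
    have h := sinc_mul_aeval_qNumber n x
    have he : Complex.exp (((n + 1 : ℕ) * ((n + 1 : ℕ) - 1) / 2) * x * Complex.I)
        = Complex.exp ((n * (n - 1) / 2) * x * Complex.I) * Complex.exp (n * x * Complex.I) := by
      rw [← Complex.exp_add]; push_cast; ring_nf
    rw [qFactorial_succ, sincProd_succ, he, Nat.factorial_succ, map_mul]
    push_cast at h ⊢
    linear_combination (Real.sinc x * aeval (Complex.exp (2 * x * Complex.I)) (qNumber (n + 1))) * ih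
      + Complex.exp ((n * (n - 1) / 2) * x * Complex.I) * n.factorial * (sincProd n x : ℝ) * h

lemma factorial_mul_factorial_succ_mul_catalan (n : ℕ) :
    n.factorial * (n + 1).factorial * catalan n = (2 * n).factorial := by
  have h := congrArg (eval (1 : ℤ)) (qFactorial_mul_qFactorial_succ_mul_qCatalan n)
  simp only [eval_mul, eval_one_qFactorial, qCatalan_eval_one] at h
  exact_mod_cast h

/-- The factorials `[n]!` and `[n+1]!` carry `2n+1` powers of `sinc x` against `2n` for `[2n]!`, so
one survives. The remaining phase is twice the mean times `x`, so centring leaves a real quantity.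
-/
lemma aeval_exp_qCatalan_div (n : ℕ) (x : ℝ) (hx : Real.sinc x ≠ 0) (h1 : sincProd n x ≠ 0)
    (h2 : sincProd (n + 1) x ≠ 0) :
    aeval (Complex.exp (2 * x * Complex.I)) (qCatalan n) / catalan n
      = Complex.exp (n * (n - 1) * x * Complex.I) *
        (Real.sinc x * sincProd (2 * n) x / (sincProd n x * sincProd (n + 1) x) : ℝ) := by
  have h := congrArg (aeval (Complex.exp (2 * x * Complex.I)))
    (qFactorial_mul_qFactorial_succ_mul_qCatalan n)
  simp only [map_mul] at h
  have e1 := sinc_pow_mul_aeval_qFactorial n x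
  have e2 := sinc_pow_mul_aeval_qFactorial (n + 1) x
  have e3 := sinc_pow_mul_aeval_qFactorial (2 * n) x
  have hf : ((n.factorial : ℂ) * (n + 1).factorial * catalan n) = (2 * n).factorial := by
    exact_mod_cast factorial_mul_factorial_succ_mul_catalan n
  rw [← hf] at e3
  have he : Complex.exp (((2 * n : ℕ) * ((2 * n : ℕ) - 1) / 2) * x * Complex.I)
      = Complex.exp ((n * (n - 1) / 2) * x * Complex.I) *
        Complex.exp (((n + 1 : ℕ) * ((n + 1 : ℕ) - 1) / 2) * x * Complex.I) *
        Complex.exp (n * (n - 1) * x * Complex.I) := by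
    rw [← Complex.exp_add, ← Complex.exp_add]; push_cast; ring_nf
  rw [he] at e3
  have hc : (catalan n : ℂ) ≠ 0 := by exact_mod_cast (catalan_pos n).ne'
  have hxC : (Real.sinc x : ℂ) ≠ 0 := by exact_mod_cast hx
  have h1C : (sincProd n x : ℂ) ≠ 0 := by exact_mod_cast h1
  have h2C : (sincProd (n + 1) x : ℂ) ≠ 0 := by exact_mod_cast h2
  have hn : (n.factorial : ℂ) ≠ 0 := by exact_mod_cast n.factorial_ne_zero
  have hn1 : ((n + 1).factorial : ℂ) ≠ 0 := by exact_mod_cast (n + 1).factorial_ne_zero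
  have k1 := Complex.exp_ne_zero ((n * (n - 1) / 2) * x * Complex.I)
  have k2 := Complex.exp_ne_zero (((n + 1 : ℕ) * ((n + 1 : ℕ) - 1) / 2) * x * Complex.I)
  generalize Complex.exp ((n * (n - 1) / 2) * x * Complex.I) = E1 at *
  generalize Complex.exp (((n + 1 : ℕ) * ((n + 1 : ℕ) - 1) / 2) * x * Complex.I) = E2 at *
  push_cast
  rw [div_eq_iff hc, mul_div_assoc', div_mul_eq_mul_div,
    eq_div_iff (mul_ne_zero h1C h2C)]
  apply mul_left_cancel₀ (mul_ne_zero (mul_ne_zero k1 k2) (mul_ne_zero hn hn1))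
  generalize aeval (Complex.exp (2 * x * Complex.I)) (qCatalan n) = c at *
  generalize aeval (Complex.exp (2 * x * Complex.I)) (qFactorial n) = f at *
  generalize aeval (Complex.exp (2 * x * Complex.I)) (qFactorial (n + 1)) = g at *
  generalize aeval (Complex.exp (2 * x * Complex.I)) (qFactorial (2 * n)) = d at *
  calc _ = (E1 * n.factorial * sincProd n x) * (E2 * (n + 1).factorial * sincProd (n + 1) x) * c := by
        ring
    _ = Real.sinc x * (Real.sinc x ^ (2 * n) * (f * g * c)) := by rw [← e1, ← e2]; ring
    _ = _ := by rw [h, e3]; ring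

/-! ### Asymptotics of `log ∘ sinc` -/

lemma abs_sinc_sub_le {y : ℝ} (hy : |y| ≤ 1) : |Real.sinc y - (1 - y ^ 2 / 6)| ≤ y ^ 4 / 100 := by
  rcases eq_or_ne y 0 with rfl | h0
  · simp
  have h := Real.sin_bound hy
  rw [Real.sinc_of_ne_zero h0]
  have hpos : 0 < |y| := abs_pos.mpr h0
  have e : Real.sin y - (y - y ^ 3 / 6) = y * (Real.sin y / y - (1 - y ^ 2 / 6)) := by
    field_simp
  rw [e, abs_mul] at h
  have e4 : |y| ^ 5 / 100 = |y| * (y ^ 4 / 100) := by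
    rw [← Even.pow_abs (by decide : Even 4) y]; ring
  rw [e4] at h
  exact le_of_mul_le_mul_left h hpos

lemma sinc_pos_of_abs_le_one {y : ℝ} (hy : |y| ≤ 1) : 0 < Real.sinc y := by
  have h := (abs_le.mp (abs_sinc_sub_le hy)).1
  have h2 : y ^ 2 ≤ 1 := (sq_le_one_iff_abs_le_one y).mpr hy
  nlinarith [sq_nonneg y]

/-- With `u = sinc y`, this combines `1 - 1/u ≤ log u ≤ u - 1` with the Taylor bound on `u`. -/
lemma abs_log_sinc_add_le {y : ℝ} (hy : |y| ≤ 1) :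
    |Real.log (Real.sinc y) + y ^ 2 / 6| ≤ y ^ 4 := by
  have hpos := sinc_pos_of_abs_le_one hy
  obtain ⟨hl, hu⟩ := abs_le.mp (abs_sinc_sub_le hy)
  have h2 : y ^ 2 ≤ 1 := (sq_le_one_iff_abs_le_one y).mpr hy
  have h0 := sq_nonneg y
  have e4 : y ^ 4 = (y ^ 2) ^ 2 := by ring
  rw [e4] at hl hu ⊢
  generalize y ^ 2 = w at *
  generalize Real.sinc y = u at *
  rw [abs_le]
  constructor
  · have h := Real.one_sub_inv_le_log_of_pos hpos
    have : -(w / 6 + w ^ 2) ≤ 1 - u⁻¹ := by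
      have h3 : 1 ≤ u * (1 + w / 6 + w ^ 2) := by
        have h4 : (1 - w / 6 - w ^ 2 / 100) * (1 + w / 6 + w ^ 2) ≤ u * (1 + w / 6 + w ^ 2) :=
          mul_le_mul_of_nonneg_right (by linarith) (by positivity)
        have h5 : w ^ 3 ≤ w ^ 2 := pow_le_pow_of_le_one h0 h2 (by norm_num)
        have h6 : w ^ 4 ≤ w ^ 2 := pow_le_pow_of_le_one h0 h2 (by norm_num)
        nlinarith [sq_nonneg w]
      have h7 : u⁻¹ ≤ 1 + w / 6 + w ^ 2 := by
        rw [inv_le_iff_one_le_mul₀ hpos]; linarith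
      linarith
    linarith
  · have := Real.log_le_sub_one_of_pos hpos
    nlinarith [sq_nonneg w]

lemma abs_natCast_mul_le_one {n i : ℕ} {x : ℝ} (hi : i < n) (hx : n * |x| ≤ 1) :
    |((i : ℝ) + 1) * x| ≤ 1 := by
  rw [abs_mul, abs_of_nonneg (by positivity)]
  refine le_trans (mul_le_mul_of_nonneg_right ?_ (abs_nonneg x)) hx
  exact_mod_cast hi

lemma sincProd_pos {n : ℕ} {x : ℝ} (hx : n * |x| ≤ 1) : 0 < sincProd n x :=
  Finset.prod_pos fun _ hi =>
    sinc_pos_of_abs_le_one (abs_natCast_mul_le_one (Finset.mem_range.mp hi) hx)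

lemma sum_range_cast_succ_sq (n : ℕ) :
    ∑ i ∈ Finset.range n, ((i : ℝ) + 1) ^ 2 = (n : ℝ) * (n + 1) * (2 * n + 1) / 6 := by
  induction n with
  | zero => simp
  | succ n ih => rw [Finset.sum_range_succ, ih]; push_cast; ring

lemma abs_log_sincProd_add_le {n : ℕ} {x : ℝ} (hx : n * |x| ≤ 1) :
    |Real.log (sincProd n x) + (n : ℝ) * (n + 1) * (2 * n + 1) / 36 * x ^ 2| ≤ (n : ℝ) ^ 5 * x ^ 4 := by
  have hb : ∀ i ∈ Finset.range n, |((i : ℝ) + 1) * x| ≤ 1 := fun i hi =>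
    abs_natCast_mul_le_one (Finset.mem_range.mp hi) hx
  -- The main term is the sum of squares `1² + ⋯ + n²` times `x²/6`.
  have e : (n : ℝ) * (n + 1) * (2 * n + 1) / 36 * x ^ 2
      = ∑ i ∈ Finset.range n, (((i : ℝ) + 1) * x) ^ 2 / 6 := by
    rw [← Finset.sum_div]
    simp only [mul_pow]
    rw [← Finset.sum_mul, sum_range_cast_succ_sq]
    ring
  rw [sincProd, Real.log_prod (fun i hi => (sinc_pos_of_abs_le_one (hb i hi)).ne'), e,
    ← Finset.sum_add_distrib]
  calc _ ≤ ∑ i ∈ Finset.range n, |Real.log (Real.sinc ((i + 1) * x)) + ((i + 1) * x) ^ 2 / 6| :=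
        Finset.abs_sum_le_sum_abs _ _
    _ ≤ ∑ i ∈ Finset.range n, (n : ℝ) ^ 4 * x ^ 4 := by
        refine Finset.sum_le_sum fun i hi => (abs_log_sinc_add_le (hb i hi)).trans ?_
        rw [mul_pow]
        have : (i : ℝ) + 1 ≤ n := by exact_mod_cast Finset.mem_range.mp hi
        gcongr
    _ = _ := by rw [Finset.sum_const, Finset.card_range, nsmul_eq_mul]; ring

/-- Gaussian approximation of the characteristic function of the centred law. -/
lemma abs_log_sincProd_ratio_add_le {n : ℕ} {x : ℝ} (hn : 1 ≤ n) (hx : 2 * n * |x| ≤ 1) :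
    |Real.log (Real.sinc x * sincProd (2 * n) x / (sincProd n x * sincProd (n + 1) x))
      + (n : ℝ) * (n - 1) * (n + 1) / 3 * x ^ 2| ≤ 100 * ((n : ℝ) ^ 5 * x ^ 4) := by
  have hn' : (1 : ℝ) ≤ n := by exact_mod_cast hn
  have ha := abs_nonneg x
  have h1 : ((1 : ℕ) : ℝ) * |x| ≤ 1 := by push_cast; nlinarith
  have h2 : ((2 * n : ℕ) : ℝ) * |x| ≤ 1 := by push_cast; exact hx
  have h3 : (n : ℝ) * |x| ≤ 1 := by nlinarith
  have h4 : ((n + 1 : ℕ) : ℝ) * |x| ≤ 1 := by push_cast; nlinarith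
  have p1 := sincProd_pos h1
  have p2 := sincProd_pos h2
  have p3 := sincProd_pos h3
  have p4 := sincProd_pos h4
  have b1 := abs_log_sincProd_add_le h1
  have b2 := abs_log_sincProd_add_le h2
  have b3 := abs_log_sincProd_add_le h3
  have b4 := abs_log_sincProd_add_le h4
  -- Reading the lone `sinc x` as `sincProd 1 x` lets one estimate serve all four factors. The
  -- errors total at most `(1 + 32 + 1 + 32) n⁵x⁴`, which is within the constant `100`.
  have hs : sincProd 1 x = Real.sinc x := by simp [sincProd]
  rw [hs] at p1 b1
  rw [Real.log_div (by positivity) (by positivity), Real.log_mul p1.ne' p2.ne',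
    Real.log_mul p3.ne' p4.ne']
  have c1 : (1 : ℝ) ≤ (n : ℝ) ^ 5 := one_le_pow₀ hn'
  have c4 : ((n : ℝ) + 1) ^ 5 ≤ 32 * (n : ℝ) ^ 5 := by
    calc ((n : ℝ) + 1) ^ 5 ≤ (2 * n) ^ 5 := by gcongr; linarith
      _ = _ := by ring
  have hx4 : 0 ≤ x ^ 4 := by positivity
  have d1 := mul_le_mul_of_nonneg_right c1 hx4
  have d4 := mul_le_mul_of_nonneg_right c4 hx4
  push_cast at b1 b2 b4
  rw [abs_le] at *
  constructor <;> nlinarith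

/-! ### Mean and variance -/

/-- The logarithmic derivative of a polynomial at `1`. -/
noncomputable def logDerivOne (p : ℤ[X]) : ℝ := aeval (1 : ℝ) (derivative p) / aeval (1 : ℝ) p

/-- The second logarithmic derivative of a polynomial at `1`. -/
noncomputable def logDerivTwo (p : ℤ[X]) : ℝ :=
  aeval (1 : ℝ) (derivative (derivative p)) / aeval (1 : ℝ) p - logDerivOne p ^ 2

/-- Additivity transfers the product formula to moments, with no need to differentiate a quotient.
-/
lemma logDerivOne_mul {p q : ℤ[X]} (hp : aeval (1 : ℝ) p ≠ 0) (hq : aeval (1 : ℝ) q ≠ 0) :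
    logDerivOne (p * q) = logDerivOne p + logDerivOne q := by
  simp only [logDerivOne, derivative_mul, map_add, map_mul]
  field_simp

lemma logDerivTwo_mul {p q : ℤ[X]} (hp : aeval (1 : ℝ) p ≠ 0) (hq : aeval (1 : ℝ) q ≠ 0) :
    logDerivTwo (p * q) = logDerivTwo p + logDerivTwo q := by
  simp only [logDerivTwo, logDerivOne, derivative_mul, map_add, map_mul]
  field_simp
  ring

lemma aeval_one_eq_eval (p : ℤ[X]) : aeval (1 : ℝ) p = (eval 1 p : ℤ) := by
  simpa using aeval_algebraMap_apply ℝ (1 : ℤ) p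

lemma aeval_one_qNumber (m : ℕ) : aeval (1 : ℝ) (qNumber m) = m := by
  simp [qNumber]

lemma aeval_one_derivative_qNumber (m : ℕ) :
    aeval (1 : ℝ) (derivative (qNumber m)) = (m : ℝ) * (m - 1) / 2 := by
  induction m with
  | zero => simp [qNumber]
  | succ m ih =>
    have h : qNumber (m + 1) = qNumber m + X ^ m := Finset.sum_range_succ _ m
    rw [h, derivative_add, map_add, ih]
    simp [derivative_X_pow]
    ring

lemma aeval_one_derivative_derivative_qNumber (m : ℕ) :
    aeval (1 : ℝ) (derivative (derivative (qNumber m))) = (m : ℝ) * (m - 1) * (m - 2) / 3 := by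
  induction m with
  | zero => simp [qNumber]
  | succ m ih =>
    have h : qNumber (m + 1) = qNumber m + X ^ m := Finset.sum_range_succ _ m
    rw [h, derivative_add, derivative_add, map_add, ih]
    -- The derivatives of `X ^ m` involve truncated exponents, so `m = 0` is separated.
    rcases m with _ | m
    · simp
    · simp [derivative_X_pow]
      ring

lemma aeval_one_qFactorial_ne_zero (n : ℕ) : aeval (1 : ℝ) (qFactorial n) ≠ 0 := by
  rw [aeval_one_eq_eval, eval_one_qFactorial]
  exact_mod_cast n.factorial_ne_zero

lemma aeval_one_qCatalan (n : ℕ) : aeval (1 : ℝ) (qCatalan n) = catalan n := by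
  rw [aeval_one_eq_eval, qCatalan_eval_one]
  simp

lemma logDerivOne_qFactorial (n : ℕ) : logDerivOne (qFactorial n) = (n : ℝ) * (n - 1) / 4 := by
  induction n with
  | zero => simp [qFactorial, logDerivOne]
  | succ n ih =>
    have hn : ((n : ℝ) + 1) ≠ 0 := by positivity
    have h : aeval (1 : ℝ) (qNumber (n + 1)) ≠ 0 := by rw [aeval_one_qNumber]; exact_mod_cast hn
    rw [qFactorial_succ, logDerivOne_mul (aeval_one_qFactorial_ne_zero n) h, ih, logDerivOne,
      aeval_one_qNumber, aeval_one_derivative_qNumber]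
    push_cast
    field_simp
    ring

/-- The factor `[m]` contributes `(m-1)(m-2)/3 - ((m-1)/2)² = (m-1)(m-5)/12`; the sum over `m ≤ n`
produces the `2n - 13`. -/
lemma logDerivTwo_qFactorial (n : ℕ) :
    logDerivTwo (qFactorial n) = (n : ℝ) * (n - 1) * (2 * n - 13) / 72 := by
  induction n with
  | zero => simp [qFactorial, logDerivTwo, logDerivOne]
  | succ n ih =>
    have hn : ((n : ℝ) + 1) ≠ 0 := by positivity
    have h : aeval (1 : ℝ) (qNumber (n + 1)) ≠ 0 := by rw [aeval_one_qNumber]; exact_mod_cast hn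
    rw [qFactorial_succ, logDerivTwo_mul (aeval_one_qFactorial_ne_zero n) h, ih, logDerivTwo,
      logDerivOne, aeval_one_qNumber, aeval_one_derivative_qNumber,
      aeval_one_derivative_derivative_qNumber]
    push_cast
    field_simp
    ring

lemma aeval_one_qCatalan_ne_zero (n : ℕ) : aeval (1 : ℝ) (qCatalan n) ≠ 0 := by
  rw [aeval_one_qCatalan]
  exact_mod_cast (catalan_pos n).ne'

lemma logDerivOne_qCatalan (n : ℕ) : logDerivOne (qCatalan n) = (n : ℝ) * (n - 1) / 2 := by
  have h := congrArg logDerivOne (qFactorial_mul_qFactorial_succ_mul_qCatalan n)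
  have h1 := aeval_one_qFactorial_ne_zero n
  have h2 := aeval_one_qFactorial_ne_zero (n + 1)
  rw [logDerivOne_mul (by rw [map_mul]; exact mul_ne_zero h1 h2) (aeval_one_qCatalan_ne_zero n),
    logDerivOne_mul h1 h2, logDerivOne_qFactorial, logDerivOne_qFactorial,
    logDerivOne_qFactorial] at h
  push_cast at h
  linear_combination h

/-- The second logarithmic derivative of a probability generating function at `1` is the variance
minus the mean, whence the subtracted term. -/
lemma logDerivTwo_qCatalan (n : ℕ) :
    logDerivTwo (qCatalan n) = (n : ℝ) * (n - 1) * (n + 1) / 6 - (n : ℝ) * (n - 1) / 2 := by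
  have h := congrArg logDerivTwo (qFactorial_mul_qFactorial_succ_mul_qCatalan n)
  have h1 := aeval_one_qFactorial_ne_zero n
  have h2 := aeval_one_qFactorial_ne_zero (n + 1)
  rw [logDerivTwo_mul (by rw [map_mul]; exact mul_ne_zero h1 h2) (aeval_one_qCatalan_ne_zero n),
    logDerivTwo_mul h1 h2, logDerivTwo_qFactorial, logDerivTwo_qFactorial,
    logDerivTwo_qFactorial] at h
  push_cast at h
  linear_combination h

lemma integral_cast_qCatalanPMF_eq (n : ℕ) :
    ∫ k, (k : ℝ) ∂(qCatalanPMF n).toMeasure = (n : ℝ) * (n - 1) / 2 := by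
  rw [integral_cast_qCatalanPMF, ← aeval_one_qCatalan, ← logDerivOne_qCatalan, logDerivOne]

lemma variance_cast_qCatalanPMF (n : ℕ) :
    variance (fun k : ℕ => (k : ℝ)) (qCatalanPMF n).toMeasure
      = (n : ℝ) * (n - 1) * (n + 1) / 6 := by
  have hL : MemLp (fun k : ℕ => (k : ℝ)) 2 (qCatalanPMF n).toMeasure :=
    (memLp_two_iff_integrable_sq Measurable.of_discrete.aestronglyMeasurable).mpr
      (integrable_qCatalanPMF n _)
  have h1 := logDerivOne_qCatalan n
  have h2 := logDerivTwo_qCatalan n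
  rw [variance_eq_sub hL]
  simp only [Pi.pow_apply]
  rw [integral_cast_sq_qCatalanPMF, integral_cast_qCatalanPMF, ← aeval_one_qCatalan, add_div]
  rw [logDerivTwo, h1] at h2
  rw [logDerivOne] at h1
  rw [h1]
  linear_combination h2

/-! ### The characteristic function of the standardized variable -/

/-- The angle `t/σ` is written as `2 (t/(2σ))` to match the evaluation point `exp (2ix)`. -/
lemma charFun_standardized {Ω : Type*} [MeasurableSpace Ω] {P : Measure Ω} {n : ℕ} {ξ : Ω → ℕ}
    (hξ : HasLaw ξ (qCatalanPMF n).toMeasure P) (c σ t : ℝ) :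
    charFun (P.map fun ω => ((ξ ω : ℝ) - c) / σ) t
      = Complex.exp (-(c * (t / σ)) * Complex.I) *
        (aeval (Complex.exp (2 * (t / (2 * σ) : ℝ) * Complex.I)) (qCatalan n) / catalan n) := by
  have hm : AEMeasurable (fun ω => ((ξ ω : ℝ) - c) / σ) P :=
    (Measurable.of_discrete (f := fun k : ℕ => ((k : ℝ) - c) / σ)).comp_aemeasurable
      hξ.aemeasurable
  rw [charFun_apply_real, integral_map hm (by fun_prop), ← integral_pow_complex_qCatalanPMF,
    ← integral_const_mul]
  have h := hξ.integral_comp (f := fun k : ℕ =>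
    Complex.exp (t * ((((k : ℝ) - c) / σ : ℝ) : ℂ) * Complex.I))
    Measurable.of_discrete.aestronglyMeasurable
  refine h.trans (integral_congr_ae (ae_of_all _ fun k => ?_))
  simp only
  rw [← Complex.exp_nat_mul, ← Complex.exp_add]
  congr 1
  push_cast
  ring

theorem tendsto_charFun_standardized {Ω : ℕ → Type*} [∀ n, MeasurableSpace (Ω n)]
    (P : ∀ n, Measure (Ω n)) (ξ : ∀ n, Ω n → ℕ)
    (hξ : ∀ n, HasLaw (ξ n) (qCatalanPMF n).toMeasure (P n)) (t : ℝ) :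
    Tendsto (fun n : ℕ => charFun ((P n).map fun ω => ((ξ n ω : ℝ) - (n : ℝ) * ((n : ℝ) - 1) / 2) /
        Real.sqrt ((n : ℝ) * ((n : ℝ) - 1) * ((n : ℝ) + 1) / 6)) t) atTop
      (nhds (Complex.exp (-(t ^ 2 / 2 : ℝ)))) := by
  set x : ℕ → ℝ := fun n =>
    t / (2 * Real.sqrt ((n : ℝ) * ((n : ℝ) - 1) * ((n : ℝ) + 1) / 6)) with hxdef
  -- For `n ≤ 1` the variance vanishes and division by zero makes `x n = 0`; these indices do not
  -- affect the limit.
  have hx2 : ∀ n : ℕ, 2 ≤ n → (n : ℝ) * (n - 1) * (n + 1) / 3 * x n ^ 2 = t ^ 2 / 2 := by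
    intro n hn
    have hn' : (2 : ℝ) ≤ n := by exact_mod_cast hn
    have hpos : 0 < (n : ℝ) * (n - 1) * (n + 1) :=
      mul_pos (mul_pos (by linarith) (by linarith)) (by linarith)
    rw [hxdef]
    simp only
    rw [div_pow, mul_pow, Real.sq_sqrt (by positivity)]
    have hn1 : (n : ℝ) - 1 ≠ 0 := by linarith
    field_simp
    ring
  have hx4 : ∀ n : ℕ, 2 ≤ n → (n : ℝ) ^ 5 * x n ^ 4 ≤ 9 * t ^ 4 / n := by
    intro n hn
    have hn' : (2 : ℝ) ≤ n := by exact_mod_cast hn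
    have h := hx2 n hn
    have hle : (n : ℝ) ^ 3 * x n ^ 2 ≤ 3 * t ^ 2 := by
      -- This is `n² ≥ 2`; it shows that `x n` is of order at most `n^(-3/2)`.
      have : (n : ℝ) ^ 3 / 2 ≤ n * (n - 1) * (n + 1) := by
        nlinarith [mul_nonneg (by linarith : (0 : ℝ) ≤ n) (by nlinarith : (0 : ℝ) ≤ (n : ℝ) ^ 2 - 2)]
      nlinarith [mul_le_mul_of_nonneg_right this (sq_nonneg (x n))]
    rw [le_div_iff₀ (by linarith)]
    calc (n : ℝ) ^ 5 * x n ^ 4 * n = (n ^ 3 * x n ^ 2) ^ 2 := by ring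
      _ ≤ (3 * t ^ 2) ^ 2 := by gcongr
      _ = _ := by ring
  have hlim0 : Tendsto (fun n : ℕ => 9 * t ^ 4 / (n : ℝ)) atTop (nhds 0) :=
    tendsto_const_div_atTop_nhds_zero_nat _
  have hsmall : ∀ᶠ n : ℕ in atTop, 2 * (n : ℝ) * |x n| ≤ 1 := by
    -- The threshold is `1/16` because `(2n|x|)⁴ = 16 n⁴x⁴ ≤ 16 n⁵x⁴`.
    have h16 := hlim0.eventually_le_const (show (0 : ℝ) < 1 / 16 by norm_num)
    filter_upwards [h16, eventually_ge_atTop 2] with n h hn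
    have hn' : (2 : ℝ) ≤ n := by exact_mod_cast hn
    have hx := (hx4 n hn).trans h
    rw [← pow_le_one_iff_of_nonneg (by positivity) (show (4 : ℕ) ≠ 0 by norm_num), mul_pow, mul_pow,
      Even.pow_abs (by decide)]
    have : (n : ℝ) ^ 4 ≤ n ^ 5 := pow_le_pow_right₀ (by linarith) (by norm_num)
    have := mul_le_mul_of_nonneg_right this (show 0 ≤ x n ^ 4 by positivity)
    linarith
  set L : ℕ → ℝ := fun n => Real.log (Real.sinc (x n) * sincProd (2 * n) (x n) /
    (sincProd n (x n) * sincProd (n + 1) (x n))) with hLdef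
  have hL : Tendsto L atTop (nhds (-(t ^ 2 / 2))) := by
    rw [tendsto_iff_norm_sub_tendsto_zero]
    refine squeeze_zero' (Eventually.of_forall fun _ => norm_nonneg _) ?_
      (by simpa using hlim0.const_mul 100)
    filter_upwards [hsmall, eventually_ge_atTop 2] with n h hn
    have hb := abs_log_sincProd_ratio_add_le (by omega : 1 ≤ n) h
    rw [hx2 n hn] at hb
    rw [Real.norm_eq_abs, sub_neg_eq_add]
    exact hb.trans (by linarith [hx4 n hn])
  refine (((Complex.continuous_exp.comp Complex.continuous_ofReal).tendsto _).comp hL).congr' ?_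
    |>.trans (by simp)
  filter_upwards [hsmall, eventually_ge_atTop 2] with n h hn
  have hn' : (2 : ℝ) ≤ n := by exact_mod_cast hn
  have ha := abs_nonneg (x n)
  have p1 := sinc_pos_of_abs_le_one (y := x n) (by nlinarith)
  have p2 := sincProd_pos (n := 2 * n) (x := x n) (by push_cast; exact h)
  have p3 := sincProd_pos (n := n) (x := x n) (by nlinarith)
  have p4 := sincProd_pos (n := n + 1) (x := x n) (by push_cast; nlinarith)
  rw [charFun_standardized (hξ n), show t / (2 * Real.sqrt _) = x n from rfl, aeval_exp_qCatalan_div n (x n) p1.ne' p3.ne' p4.ne',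
    ← mul_assoc, ← Complex.exp_add]
  -- The phase from subtracting the mean cancels the phase of `C_n` on the circle.
  have hphase : (-(((n : ℝ) * ((n : ℝ) - 1) / 2 : ℝ) *
      (t / (Real.sqrt ((n : ℝ) * ((n : ℝ) - 1) * ((n : ℝ) + 1) / 6) : ℝ))) * Complex.I
      + n * (n - 1) * x n * Complex.I : ℂ) = 0 := by
    rw [hxdef]
    push_cast
    ring
  rw [hphase, Complex.exp_zero, one_mul]
  simp only [Function.comp_apply]
  rw [← Complex.ofReal_exp, hLdef]
  simp only
  rw [Real.exp_log (by positivity)]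

theorem theorem1 {Ω : ℕ → Type*} [∀ n, MeasurableSpace (Ω n)] (P : ∀ n, Measure (Ω n))
    [∀ n, IsProbabilityMeasure (P n)]
    (ξ : ∀ n, Ω n → ℕ) (hξ : ∀ n, HasLaw (ξ n) (qCatalanPMF n).toMeasure (P n))
    {Ω' : Type*} [MeasurableSpace Ω'] (P' : Measure Ω') [IsProbabilityMeasure P']
    (Z : Ω' → ℝ) (hZ : HasLaw Z (gaussianReal 0 1) P') :
    (∀ n : ℕ, ∫ ω, (ξ n ω : ℝ) ∂(P n) = (n : ℝ) * ((n : ℝ) - 1) / 2 ∧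
      variance (fun ω => (ξ n ω : ℝ)) (P n) = (n : ℝ) * ((n : ℝ) - 1) * ((n : ℝ) + 1) / 6) ∧
    TendstoInDistribution
      (fun (n : ℕ) (ω : Ω n) => ((ξ n ω : ℝ) - (n : ℝ) * ((n : ℝ) - 1) / 2) /
        Real.sqrt ((n : ℝ) * ((n : ℝ) - 1) * ((n : ℝ) + 1) / 6))
      atTop Z P P' := by
  refine ⟨fun n => ⟨?_, ?_⟩, ?_⟩
  · rw [← integral_cast_qCatalanPMF_eq]
    exact (hξ n).integral_comp (f := fun k : ℕ => (k : ℝ))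
      Measurable.of_discrete.aestronglyMeasurable
  · rw [← variance_cast_qCatalanPMF, ← (hξ n).map_eq,
      variance_map Measurable.of_discrete.aemeasurable (hξ n).aemeasurable]
    rfl
  · refine ⟨fun n => (Measurable.of_discrete (f := fun k : ℕ =>
        ((k : ℝ) - (n : ℝ) * ((n : ℝ) - 1) / 2) /
          Real.sqrt ((n : ℝ) * ((n : ℝ) - 1) * ((n : ℝ) + 1) / 6))).comp_aemeasurable
      (hξ n).aemeasurable, hZ.aemeasurable, ?_⟩
    -- Lévy's continuity theorem reduces the claim to the pointwise limit of characteristic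
    -- functions.
    refine ProbabilityMeasure.tendsto_iff_tendsto_charFun.2 fun t => ?_
    have h : charFun (P'.map Z) t = Complex.exp (-(t ^ 2 / 2 : ℝ)) := by
      rw [hZ.map_eq, charFun_gaussianReal]
      simp
    simp only [ProbabilityMeasure.coe_mk]
    rw [h]
    exact tendsto_charFun_standardized P ξ hξ t
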